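/- Expressions are terms of the untyped $\lambda$-calculus with named variables (names are strings): $e ::= \mathrm{Var}\,v \mid \mathrm{Lam}\,x\,e \mid \mathrm{App}\,e_1\,e_2$; $|e|$ is the number of nodes of $e$, and $e_1\not\equiv e_2$ means that $e_1,e_2$ are not $\alpha$-equivalent. Let $b\ge 1$, $\mathbb H=\{0,1\}^b$, $\mathbb H_\bot=\mathbb H\cup\{\bot\}$, and let $\oplus$ be bitwise XOR. A *hashing instantiation* consists of constants $s_0,p_0\in\mathbb H$ and functions $$s_L:\mathbb N\times\mathbb H_\bot\times\mathbb H\to\mathbb H,\quad s_A:\mathbb N\times\{0,1\}\times\mathbb H^2\to\mathbb H,\quad p_J:\mathbb N^2\times\mathbb H_\bot\times\mathbb H\to\mathbb H,$$ $$\eta:\mathrm{Names}\times\mathbb H\to\mathbb H,\quad c:\mathbb H^2\to\mathbb H .$$ Given an instantiation, $\mathrm{summariseExpr}(e)=(\sigma,m)$ is defined by recursion on $e$. Here $\sigma$ is the structure of $e$, represented by a hash code together with a size and a depth. The variable map $m$ is a finite map from the free variables of $e$ to position trees, each represented by a hash code together with a size. Along with $m$ one maintains $\mathrm{hash}(m)\in\mathbb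 H$: whenever an entry $(v,p)$ is added to $m$ or removed from it, $\mathrm{hash}(m)$ is replaced by $\mathrm{hash}(m)\oplus\eta(v,\mathrm{hash}(p))$ (replacing the value at $v$ does both), so that $\mathrm{hash}(m)=\bigoplus_{(v,p)\in m}\eta(v,\mathrm{hash}(p))$. * $\mathrm{Var}\,v$: $\sigma$ has hash $s_0$, size $1$ and depth $1$; $m=\{v\mapsto p\}$, where $p$ has hash $p_0$ and size $1$. * $\mathrm{Lam}\,x\,e'$, with $\mathrm{summariseExpr}(e')=(\sigma',m')$: $m$ is $m'$ with $x$ removed; $\sigma$ has size $n=\mathrm{size}(\sigma')+1$, depth $\mathrm{depth}(\sigma')+1$ and hash $s_L(n,\mathrm{hash}(m'(x)),\mathrm{hash}(\sigma'))$, with $\bot$ in the second place if $x$ is not in $m'$. * $\mathrm{App}\,e_1\,e_2$, with $\mathrm{summariseExpr}(e_i)=(\sigma_i,m_i)$: let $\ell=1$ if $m_1$ has strictly more entries than $m_2$, and $\ell=0$ otherwise; the bigger map is $m_1$ if $\ell=1$ and $m_2$ if $\ell=0$, and the smaller map is the other one. Then $\sigma$ has size $n=\mathrm{size}(\sigma_1)+\mathrm{size}(\sigma_2)+1$,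 depth $t=\max(\mathrm{depth}(\sigma_1),\mathrm{depth}(\sigma_2))+1$ and hash $s_A(n,\ell,\mathrm{hash}(\sigma_1),\mathrm{hash}(\sigma_2))$. The map $m$ is obtained from the bigger map as follows: for each entry $(v,p)$ of the smaller map, the value at $v$ becomes the position tree of size $k=\mathrm{size}(q)+\mathrm{size}(p)+1$ and hash $p_J(k,t,\mathrm{hash}(q),\mathrm{hash}(p))$, where $q$ is the value at $v$ in the bigger map (if $v$ is not in the bigger map, $\mathrm{size}(q)$ is read as $0$ and $\mathrm{hash}(q)$ as $\bot$). Finally $\mathrm{hashESummary}(\sigma,m)=c(\mathrm{hash}(\sigma),\mathrm{hash}(m))$ and $h(e)=\mathrm{hashESummary}(\mathrm{summariseExpr}(e))$. **Theorem.** For every $b\ge1$ there is a random hashing instantiation (defined on some probability space, and not depending on any expression) such that $h(e)$ is a random variable for every expression $e$, and for all expressions $e_1,e_2$ with $e_1\not\equiv e_2$, $$P\bigl(h(e_1)=h(e_2)\bigr)\le 5\,\frac{|e_1|+|e_2|}{2^b}.$$ -/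

import Mathlib

namespace AlphaHash

/-! ### Expressions and α-equivalence -/

abbrev Name := String

/-- Expressions of the untyped λ-calculus, with named variables. -/
inductive Expression where
  | var (v : Name)
  | lam (x : Name) (e : Expression)
  | app (e₁ e₂ : Expression)

/-- The number of nodes `|e|` of an expression. -/
def Expression.size : Expression → ℕ
  | .var _ => 1
  | .lam _ e => e.size + 1
  | .app e₁ e₂ => e₁.size + e₂.size + 1

/-- The variable occurrences `x` (on the left) and `y` (on the right) match under the list `Γ` of
pairs of enclosing binders, innermost pair first: either they refer to the same pair of binders, or
both are free and they are the same name. -/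
def VarMatch : List (Name × Name) → Name → Name → Prop
  | [], x, y => x = y
  | (a, c) :: Γ, x, y => (x = a ∧ y = c) ∨ (x ≠ a ∧ y ≠ c ∧ VarMatch Γ x y)

/-- α-equivalence of two expressions under a list of pairs of enclosing binders. -/
def AlphaEquivUnder : List (Name × Name) → Expression → Expression → Prop
  | Γ, .var x, .var y => VarMatch Γ x y
  | Γ, .lam x e, .lam y e' => AlphaEquivUnder ((x, y) :: Γ) e e'
  | Γ, .app e₁ e₂, .app e₁' e₂' => AlphaEquivUnder Γ e₁ e₁' ∧ AlphaEquivUnder Γ e₂ e₂'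
  | _, _, _ => False

/-- α-equivalence: equality up to renaming of the λ-bound variables. -/
def AlphaEquiv (e₁ e₂ : Expression) : Prop := AlphaEquivUnder [] e₁ e₂

/-! ### Hash codes, hashing functions and combiners -/

/-- The set `{0,1}^b` of hash codes of width `b`. -/
abbrev HashCode (b : ℕ) := Fin b → Bool

/-- Bitwise exclusive or. -/
def HashCode.xor {b : ℕ} (g h : HashCode b) : HashCode b := fun i => Bool.xor (g i) (h i)

/-- A choice of all the hashing functions and combiners with which the algorithm is instantiated.
Sub-objects enter a combiner only through their hash codes; a combiner also sees the size (the
number of constructor calls) of the object that is being built. -/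
structure Hashing (b : ℕ) where
  /-- the hash code of an anonymous variable -/
  sVar : HashCode b
  /-- combiner for a lambda: size, position tree of the bound variable (if it occurs), body -/
  sLam : (size : ℕ) → Option (HashCode b) → HashCode b → HashCode b
  /-- combiner for an application: size, "left has more free variables" flag, left, right -/
  sApp : (size : ℕ) → Bool → HashCode b → HashCode b → HashCode b
  /-- the hash code of the one-point position tree -/
  ptHere : HashCode b
  /-- combiner for joined position trees: size, structure tag, tree from the bigger map (if any),
  tree from the smaller map -/
  ptJoin : (size : ℕ) → (tag : ℕ) → Option (HashCode b) → HashCode b → HashCode b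
  /-- hash of a variable map entry -/
  entry : Name → HashCode b → HashCode b
  /-- combiner for the hash of the structure and the hash of the variable map -/
  summary : HashCode b → HashCode b → HashCode b

/-! ### Structures, position trees and variable maps, represented by their hash codes -/

/-- A structure, represented by its hash code; its number of constructors and its depth are
computed and stored when it is built. -/
structure Structure (b : ℕ) where
  hash : HashCode b
  size : ℕ
  depth : ℕ

/-- The tag of a structure: larger than the tag of each of its proper sub-structures. -/
def structureTag {b : ℕ} (s : Structure b) : ℕ := s.depth

/-- A position tree, represented by its hash code; its number of constructors is stored. -/
structure PosTree (b : ℕ) where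
  hash : HashCode b
  size : ℕ

/-- A variable map: a finite map from names to position trees, together with its hash. -/
structure VarMap (b : ℕ) where
  entries : AList (fun _ : Name => PosTree b)
  hash : HashCode b

structure ESummary (b : ℕ) where
  str : Structure b
  vm : VarMap b

section Algorithm

variable {b : ℕ} (H : Hashing b)

def mkSVar : Structure b := ⟨H.sVar, 1, 1⟩

def mkSLam (p : Option (PosTree b)) (s : Structure b) : Structure b :=
  ⟨H.sLam (s.size + 1) (p.map PosTree.hash) s.hash, s.size + 1, s.depth + 1⟩

def mkSApp (leftBigger : Bool) (s₁ s₂ : Structure b) : Structure b :=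
  ⟨H.sApp (s₁.size + s₂.size + 1) leftBigger s₁.hash s₂.hash,
    s₁.size + s₂.size + 1, max s₁.depth s₂.depth + 1⟩

def mkPTHere : PosTree b := ⟨H.ptHere, 1⟩

/-- `big` is the child from the bigger map (if there is one), `small` that from the smaller map. -/
def mkPTJoin (tag : ℕ) (big : Option (PosTree b)) (small : PosTree b) : PosTree b :=
  ⟨H.ptJoin ((big.map PosTree.size).getD 0 + small.size + 1) tag (big.map PosTree.hash) small.hash,
    (big.map PosTree.size).getD 0 + small.size + 1⟩

def entryHash (key : Name) (pos : PosTree b) : HashCode b := H.entry key pos.hash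

def singletonVM (key : Name) (pos : PosTree b) : VarMap b :=
  ⟨AList.singleton key pos, entryHash H key pos⟩

/-- Alter the value to which `key` is mapped, and update the hash of the map. -/
def alterVM (f : Option (PosTree b) → PosTree b) (key : Name) (m : VarMap b) : VarMap b :=
  match m.entries.lookup key with
  | some oldPt =>
      ⟨m.entries.insert key (f (some oldPt)),
        (m.hash.xor (entryHash H key oldPt)).xor (entryHash H key (f (some oldPt)))⟩
  | none =>
      ⟨m.entries.insert key (f none), m.hash.xor (entryHash H key (f none))⟩

/-- Remove `key` from the map, and return what it was mapped to (if anything). -/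
def removeFromVM (key : Name) (m : VarMap b) : VarMap b × Option (PosTree b) :=
  match m.entries.lookup key with
  | some pt => (⟨m.entries.erase key, m.hash.xor (entryHash H key pt)⟩, some pt)
  | none => (m, none)

/-- Does the first map have more entries than the second? -/
def isBiggerThanVM (m₁ m₂ : VarMap b) : Bool :=
  decide (m₂.entries.entries.length < m₁.entries.entries.length)

/-- Add all entries of the smaller map, one by one, to the bigger map. -/
def joinVM (tag : ℕ) (big small : VarMap b) : VarMap b :=
  small.entries.entries.foldr
    (fun kv m => alterVM H (fun mp => mkPTJoin H tag mp kv.2) kv.1 m) big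

/-- The e-summary of an expression, with all hashes computed compositionally. -/
def summariseExpr : Expression → ESummary b
  | .var v => ⟨mkSVar H, singletonVM H v (mkPTHere H)⟩
  | .lam x e =>
      let s := summariseExpr e
      let r := removeFromVM H x s.vm
      ⟨mkSLam H r.2 s.str, r.1⟩
  | .app e₁ e₂ =>
      let s₁ := summariseExpr e₁
      let s₂ := summariseExpr e₂
      let leftBigger := isBiggerThanVM s₁.vm s₂.vm
      let str := mkSApp H leftBigger s₁.str s₂.str
      let big := if leftBigger then s₁.vm else s₂.vm
      let small := if leftBigger then s₂.vm else s₁.vm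
      ⟨str, joinVM H (structureTag str) big small⟩

def hashESummary (s : ESummary b) : HashCode b := H.summary s.str.hash s.vm.hash

/-- The hash of an expression. -/
def hashExpr (e : Expression) : HashCode b := hashESummary H (summariseExpr H e)

end Algorithm

end AlphaHash

/-!
Answer all queries to the hashing functions and combiners by independent uniform hash codes. Every
hash computed by the algorithm is then the answer to a query built from the answers to queries of
smaller rank. When two such queries differ, the one whose rank is not the smaller is still
unanswered once the other one is answered, so their answers agree with probability at most `2⁻ᵇ`.

Before hashing, the structure and the variable map determine an expression up to α-equivalence: a
join is tagged with a depth exceeding all the tags inside its two arguments, so the join of two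
variable maps can be undone. Hence for expressions that are not α-equivalent the structures differ,
or the position trees of some name `v` do. Descending along the first difference, two distinct
structures or position trees receive the same hash with probability at most `2⁻ᵇ` per level. When
the position trees at `v` have different hashes, the entry query at `v` in one map is made for no
other entry of the two maps, so the two exclusive ors agree with probability at most `2⁻ᵇ`.
The summary costs another `2⁻ᵇ`, which gives `(max (depth e₁) (depth e₂) + 2) / 2ᵇ` in total.
-/

open MeasureTheory ProbabilityTheory Function
open scoped ENNReal

namespace RandomOracle

/-! ### Random oracles -/

section ProductMeasure

variable {ι : Type*} {X : ι → Type*} [∀ i, MeasurableSpace (X i)]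

theorem measurableSet_cylinderEvents_compl_singleton [DecidableEq ι] {i : ι} {T : Set (∀ i, X i)}
    (hT : MeasurableSet T) (h_update : ∀ ω ∈ T, ∀ c, update ω i c ∈ T) :
    MeasurableSet[cylinderEvents {i}ᶜ] T := by
  rcases T.eq_empty_or_nonempty with rfl | ⟨ω₀, -⟩
  · exact @MeasurableSet.empty _ (cylinderEvents {i}ᶜ)
  have h_preimage : (fun ω => update ω i (ω₀ i)) ⁻¹' T = T := by
    ext ω
    refine ⟨fun hω => ?_, fun hω => h_update ω hω _⟩
    simpa using h_update _ hω (ω i)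
  have h_meas : Measurable[cylinderEvents {i}ᶜ] fun ω : ∀ i, X i => update ω i (ω₀ i) := by
    refine @measurable_pi_lambda _ _ _ (cylinderEvents {i}ᶜ) _ _ fun j => ?_
    rcases eq_or_ne j i with rfl | hj
    · simp only [update_self, measurable_const]
    · simpa only [update_of_ne hj] using measurable_cylinderEvent_apply (Δ := {i}ᶜ) hj
  exact h_preimage ▸ h_meas hT

theorem dependsOn_of_measurable_cylinderEvents {β : Type*} [MeasurableSpace β]
    [MeasurableSingletonClass β] {Δ : Set ι} {F : (∀ i, X i) → β}
    (hF : Measurable[cylinderEvents Δ] F) : DependsOn F Δ := by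
  have h_le : cylinderEvents Δ ≤ MeasurableSpace.comap (Δ.domRestrict (π := X)) inferInstance :=
    iSup₂_le fun i hi => Measurable.comap_le <|
      (measurable_pi_apply (X := fun j : Δ => X j) ⟨i, hi⟩).comp (comap_measurable Δ.domRestrict)
  exact dependsOn_iff_factorsThrough.2 (hF.mono h_le le_rfl).factorsThrough

theorem infinitePi_inter_eval_preimage (μ : ∀ i, Measure (X i)) [∀ i, IsProbabilityMeasure (μ i)]
    {i : ι} {T : Set (∀ i, X i)} (hT : MeasurableSet[cylinderEvents {i}ᶜ] T) {s : Set (X i)}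
    (hs : MeasurableSet s) :
    Measure.infinitePi μ (T ∩ eval i ⁻¹' s) = Measure.infinitePi μ T * μ i s := by
  have h_indep : Indep (cylinderEvents {i}ᶜ) (cylinderEvents {i}) (Measure.infinitePi μ) :=
    indep_iSup_of_disjoint (fun j => (measurable_pi_apply j).comap_le)
      (iIndepFun_infinitePi (X := fun _ x => x) fun _ => measurable_id) disjoint_compl_left
  have hs' : MeasurableSet[cylinderEvents {i}] (eval i ⁻¹' s : Set (∀ i, X i)) :=
    measurable_cylinderEvent_apply (X := X) (Set.mem_singleton i) hs
  rw [(Indep_iff _ _ _).1 h_indep T _ hT hs',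
    (measurePreserving_eval_infinitePi μ i).measure_preimage hs.nullMeasurableSet]

end ProductMeasure

section Collision

variable {ι α : Type*} [Countable ι] [MeasurableSpace ι] [MeasurableSingletonClass ι]
  [Countable α] [MeasurableSpace α] [MeasurableSingletonClass α]
  {μ : ι → Measure α} [∀ i, IsProbabilityMeasure (μ i)] {ε : ℝ≥0∞}

theorem measure_answer_eq_le [DecidableEq ι] (hμ : ∀ i a, μ i {a} ≤ ε) {E : Set (ι → α)}
    (hE : MeasurableSet E) {A : (ι → α) → ι} (hA : Measurable A) {B : (ι → α) → α}
    (hB : Measurable B) (h_update : ∀ ω ∈ E, ∀ c, update ω (A ω) c ∈ E ∧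
      A (update ω (A ω) c) = A ω ∧ B (update ω (A ω) c) = B ω) :
    Measure.infinitePi μ {ω ∈ E | ω (A ω) = B ω} ≤ ε := by
  let T (x : ι × α) : Set (ι → α) := E ∩ A ⁻¹' {x.1} ∩ B ⁻¹' {x.2}
  have hT (x : ι × α) : MeasurableSet (T x) :=
    (hE.inter (hA (.singleton _))).inter (hB (.singleton _))
  have h_fresh (x : ι × α) : MeasurableSet[cylinderEvents {x.1}ᶜ] (T x) := by
    refine measurableSet_cylinderEvents_compl_singleton (hT x) ?_
    rintro ω ⟨⟨hω, hAω⟩, hBω⟩ c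
    obtain ⟨hE', hA', hB'⟩ := h_update ω hω c
    rw [hAω] at hE' hA' hB'
    exact ⟨⟨hE', hA'⟩, hB'.trans hBω⟩
  have h_disjoint : Pairwise (Disjoint on T) := fun x y hxy =>
    Set.disjoint_left.2 fun ω hx hy =>
      hxy (Prod.ext (hx.1.2.symm.trans hy.1.2) (hx.2.symm.trans hy.2))
  calc Measure.infinitePi μ {ω ∈ E | ω (A ω) = B ω}
      ≤ Measure.infinitePi μ (⋃ x, T x ∩ eval x.1 ⁻¹' {x.2}) :=
        measure_mono fun ω hω => Set.mem_iUnion.2 ⟨(A ω, B ω), ⟨⟨hω.1, rfl⟩, rfl⟩, hω.2⟩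
    _ ≤ ∑' x, Measure.infinitePi μ (T x ∩ eval x.1 ⁻¹' {x.2}) := measure_iUnion_le _
    _ = ∑' x, Measure.infinitePi μ (T x) * μ x.1 {x.2} :=
        tsum_congr fun x => infinitePi_inter_eval_preimage μ (h_fresh x) (.singleton _)
    _ ≤ ∑' x, Measure.infinitePi μ (T x) * ε := by gcongr with x; exact hμ _ _
    _ = Measure.infinitePi μ (⋃ x, T x) * ε := by
        rw [ENNReal.tsum_mul_right, measure_iUnion h_disjoint hT]
    _ ≤ ε := mul_le_of_le_one_left' prob_le_one

end Collision

section Measurability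

theorem measurable_map₂ {Ω β γ δ : Type*} {_ : MeasurableSpace Ω} [MeasurableSpace β]
    [MeasurableSpace γ] [MeasurableSpace δ] [DiscreteMeasurableSpace (β × γ)] {F : Ω → β}
    {G : Ω → γ} (f : β → γ → δ) (hF : Measurable F) (hG : Measurable G) :
    Measurable fun ω => f (F ω) (G ω) :=
  (Measurable.of_discrete (f := uncurry f)).comp (hF.prodMk hG)

theorem measurable_cylinderEvents_answer {ι α : Type*} [MeasurableSpace α] [MeasurableSpace ι]
    [Countable ι] [MeasurableSingletonClass ι] {Δ : Set ι} {A : (ι → α) → ι}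
    (hA : Measurable[cylinderEvents Δ] A) (h_mem : ∀ ω, A ω ∈ Δ) :
    Measurable[cylinderEvents Δ] fun ω => ω (A ω) := by
  intro s hs
  have h_cover : (fun ω : ι → α => ω (A ω)) ⁻¹' s =
      ⋃ i ∈ Δ, A ⁻¹' {i} ∩ (fun ω : ι → α => ω i) ⁻¹' s := by
    ext ω
    simp only [Set.mem_preimage, Set.mem_iUnion, Set.mem_inter_iff, Set.mem_singleton_iff]
    exact ⟨fun hω => ⟨A ω, h_mem ω, rfl, hω⟩, fun ⟨_, _, hi, hω⟩ => hi ▸ hω⟩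
  rw [h_cover]
  exact MeasurableSet.biUnion (Set.to_countable Δ) fun i hi =>
    (hA (.singleton i)).inter (measurable_cylinderEvent_apply hi hs)

end Measurability

section Rank

variable {ι α κ : Type*} [MeasurableSpace α]

/-- The σ-algebra generated by the answers to the queries of rank less than `r`. -/
abbrev answersBelow [LT κ] (rank : ι → κ) (r : κ) : MeasurableSpace (ι → α) :=
  cylinderEvents {i | rank i < r}

theorem update_eq_of_measurable_answersBelow [Preorder κ] [DecidableEq ι] {β : Type*}
    [MeasurableSpace β] [MeasurableSingletonClass β] {rank : ι → κ} {r : κ} {F : (ι → α) → β}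
    (hF : Measurable[answersBelow rank r] F) {i : ι} (hi : r ≤ rank i) (ω : ι → α) (c : α) :
    F (update ω i c) = F ω := by
  refine dependsOn_of_measurable_cylinderEvents hF fun j hj => update_of_ne ?_ _ _
  rintro rfl
  exact (hi.trans_lt hj).false

/-- The random query `A` has rank `r`, and is determined by the answers to the queries of smaller
rank. -/
structure IsQueryOfRank [LT κ] [MeasurableSpace ι] (rank : ι → κ) (r : κ) (A : (ι → α) → ι) :
    Prop where
  measurable : Measurable[answersBelow rank r] A
  rank_eq : ∀ ω, rank (A ω) = r

variable [MeasurableSpace ι] [MeasurableSingletonClass ι] [Countable ι]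

namespace IsQueryOfRank

theorem measurable_answer [Preorder κ] {rank : ι → κ} {r r' : κ} {A : (ι → α) → ι}
    (hA : IsQueryOfRank rank r A) (hr : r < r') :
    Measurable[answersBelow rank r'] fun ω => ω (A ω) :=
  measurable_cylinderEvents_answer
    (hA.measurable.mono (cylinderEvents_mono fun _ hi => hi.trans hr) le_rfl)
    fun ω => (hA.rank_eq ω).trans_lt hr

variable [LinearOrder κ] {rank : ι → κ} {r r' : κ} {A A' : (ι → α) → ι}
  [Countable α] [MeasurableSingletonClass α] {μ : ι → Measure α} [∀ i, IsProbabilityMeasure (μ i)]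
  {ε : ℝ≥0∞}

theorem measure_ne_and_answer_eq_le (hA : IsQueryOfRank rank r A) (hA' : IsQueryOfRank rank r' A')
    (hμ : ∀ i a, μ i {a} ≤ ε) :
    Measure.infinitePi μ {ω | A ω ≠ A' ω ∧ ω (A ω) = ω (A' ω)} ≤ ε := by
  classical
  wlog hr : r' ≤ r generalizing r r' A A'
  · simpa only [ne_comm, eq_comm] using this hA' hA (not_le.1 hr).le
  have hA_meas : Measurable A := hA.measurable.mono cylinderEvents_le_pi le_rfl
  have hA'_meas : Measurable A' := hA'.measurable.mono cylinderEvents_le_pi le_rfl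
  refine measure_answer_eq_le hμ (E := {ω | A ω ≠ A' ω}) (B := fun ω => ω (A' ω))
    (measurableSet_eq_fun hA_meas hA'_meas).compl hA_meas ?_ fun ω hω c => ?_
  · exact (measurable_cylinderEvents_answer (hA'_meas.mono cylinderEvents_univ.ge le_rfl)
      fun _ => Set.mem_univ _).mono cylinderEvents_le_pi le_rfl
  · have h_eq : A (update ω (A ω) c) = A ω :=
      update_eq_of_measurable_answersBelow hA.measurable (hA.rank_eq ω).ge ω c
    have h_eq' : A' (update ω (A ω) c) = A' ω :=
      update_eq_of_measurable_answersBelow hA'.measurable (hr.trans_eq (hA.rank_eq ω).symm) ω c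
    refine ⟨?_, h_eq, ?_⟩
    · rwa [Set.mem_ofPred_eq, h_eq, h_eq']
    · simp only [h_eq', update_of_ne (Ne.symm hω)]

theorem measure_answer_eq_le_succ (hA : IsQueryOfRank rank r A) (hA' : IsQueryOfRank rank r' A')
    (hμ : ∀ i a, μ i {a} ≤ ε) {n : ℕ} (h_eq : Measure.infinitePi μ {ω | A ω = A' ω} ≤ n * ε) :
    Measure.infinitePi μ {ω | ω (A ω) = ω (A' ω)} ≤ (n + 1 : ℕ) * ε := by
  have h_cases : {ω | ω (A ω) = ω (A' ω)} ⊆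
      {ω | A ω = A' ω} ∪ {ω | A ω ≠ A' ω ∧ ω (A ω) = ω (A' ω)} := fun ω hω =>
    (em (A ω = A' ω)).imp id fun h => ⟨h, hω⟩
  rw [Nat.cast_succ, add_one_mul]
  exact (measure_mono h_cases).trans <| (measure_union_le _ _).trans <|
    add_le_add h_eq (hA.measure_ne_and_answer_eq_le hA' hμ)

end IsQueryOfRank

end Rank

end RandomOracle

namespace AlphaHash

/-! ### Summaries before hashing -/

/-- Position trees before hashing: where a variable occurs in an expression. `graft` is a join in
which the variable is absent from the bigger map. -/
inductive PosTerm where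
  | here
  | graft (tag : ℕ) (small : PosTerm)
  | join (tag : ℕ) (big small : PosTerm)

namespace PosTerm

/-- The number of constructors, stored in a `PosTree` along with the hash. -/
def size : PosTerm → ℕ
  | here => 1
  | graft _ p => p.size + 1
  | join _ q p => q.size + p.size + 1

/-- The number of levels, hence of nested hash evaluations. -/
def height : PosTerm → ℕ
  | here => 1
  | graft _ p => p.height + 1
  | join _ q p => max q.height p.height + 1

/-- The tag of the outermost join, or `0` if there is none. -/
def tag : PosTerm → ℕ
  | here => 0
  | graft t _ => t
  | join t _ _ => t

/-- The value at a name of the join with tag `t` of two variable maps, the bigger one first, in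
terms of its values there. -/
def combine (t : ℕ) : Option PosTerm → Option PosTerm → Option PosTerm
  | big, none => big
  | none, some p => some (graft t p)
  | some q, some p => some (join t q p)

theorem combine_eq_none {t : ℕ} {q p : Option PosTerm} :
    combine t q p = none ↔ q = none ∧ p = none := by
  rcases q with _ | q <;> rcases p with _ | p <;> simp [combine]

theorem tag_combine_le {t : ℕ} {q : Option PosTerm} (hq : q.elim 0 tag ≤ t) (p : Option PosTerm) :
    (combine t q p).elim 0 tag ≤ t := by
  rcases q with _ | q <;> rcases p with _ | _ <;> simp_all [combine, tag]

theorem height_combine_le (t : ℕ) (q p : Option PosTerm) :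
    (combine t q p).elim 0 height ≤ max (q.elim 0 height) (p.elim 0 height) + 1 := by
  rcases q with _ | q <;> rcases p with _ | p <;> simp [combine, height]

/-- A join tagged above all earlier tags shows from which of the two maps a value comes. -/
theorem combine_inj {t : ℕ} {q q' p p' : Option PosTerm} (hq : q.elim 0 tag < t)
    (hq' : q'.elim 0 tag < t) (h : combine t q p = combine t q' p') : q = q' ∧ p = p' := by
  rcases q with _ | q <;> rcases p with _ | p <;> rcases q' with _ | q' <;>
    rcases p' with _ | p' <;> grind [combine, tag]

end PosTerm

/-- Structures before hashing. -/
inductive StructTerm where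
  | var
  | lam (p : Option PosTerm) (s : StructTerm)
  | app (leftBigger : Bool) (s₁ s₂ : StructTerm)

namespace StructTerm

/-- The size stored in a `Structure`; position trees are not counted. -/
def size : StructTerm → ℕ
  | var => 1
  | lam _ s => s.size + 1
  | app _ s₁ s₂ => s₁.size + s₂.size + 1

/-- The depth stored in a `Structure`; position trees are not counted. -/
def depth : StructTerm → ℕ
  | var => 1
  | lam _ s => s.depth + 1
  | app _ s₁ s₂ => max s₁.depth s₂.depth + 1

/-- The number of nested hash evaluations: unlike `depth`, this counts position trees. -/
def height : StructTerm → ℕ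
  | var => 1
  | lam p s => max (p.elim 0 PosTerm.height) s.height + 1
  | app _ s₁ s₂ => max s₁.height s₂.height + 1

end StructTerm

namespace Expression

/-- The set of free variables. -/
def freeVars : Expression → Finset Name
  | var v => {v}
  | lam x e => e.freeVars.erase x
  | app e₁ e₂ => e₁.freeVars ∪ e₂.freeVars

/-- The nesting depth of an expression. -/
def depth : Expression → ℕ
  | var _ => 1
  | lam _ e => e.depth + 1
  | app e₁ e₂ => max e₁.depth e₂.depth + 1

/-- The “left has more free variables” flag of an application. -/
def leftBigger (e₁ e₂ : Expression) : Bool := decide (e₂.freeVars.card < e₁.freeVars.card)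

/-- The variable map before hashing; the names that are not free are mapped to `none`. -/
def pos : Expression → Name → Option PosTerm
  | var v => update (fun _ => none) v (some .here)
  | lam x e => update e.pos x none
  | app e₁ e₂ => fun u =>
      if leftBigger e₁ e₂ then PosTerm.combine (max e₁.depth e₂.depth + 1) (e₁.pos u) (e₂.pos u)
      else PosTerm.combine (max e₁.depth e₂.depth + 1) (e₂.pos u) (e₁.pos u)

/-- The structure of an expression before hashing. -/
def skeleton : Expression → StructTerm
  | var _ => .var
  | lam x e => .lam (e.pos x) e.skeleton
  | app e₁ e₂ => .app (leftBigger e₁ e₂) e₁.skeleton e₂.skeleton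

theorem size_pos (e : Expression) : 0 < e.size := by
  cases e <;> simp [size]

theorem depth_le_size (e : Expression) : e.depth ≤ e.size := by
  induction e with
  | var v => exact le_rfl
  | lam _ e ih => exact Nat.succ_le_succ ih
  | app e₁ e₂ ih₁ ih₂ => simp only [depth, size]; omega

theorem depth_skeleton (e : Expression) : e.skeleton.depth = e.depth := by
  induction e with
  | var v => rfl
  | lam x e ih => simp only [skeleton, StructTerm.depth, depth, ih]
  | app e₁ e₂ ih₁ ih₂ => simp only [skeleton, StructTerm.depth, depth, ih₁, ih₂]

theorem mem_freeVars_iff {e : Expression} {u : Name} : u ∈ e.freeVars ↔ e.pos u ≠ none := by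
  induction e with
  | var v => by_cases h : u = v <;> simp [freeVars, pos, h]
  | lam x e ih => by_cases h : u = x <;> simp [freeVars, pos, h, ih]
  | app e₁ e₂ ih₁ ih₂ =>
    cases h : leftBigger e₁ e₂ <;>
      simp [freeVars, pos, h, ih₁, ih₂, PosTerm.combine_eq_none, imp_iff_not_or, or_comm]

theorem tag_pos_le_depth (e : Expression) (u : Name) : (e.pos u).elim 0 PosTerm.tag ≤ e.depth := by
  induction e with
  | var v => by_cases h : u = v <;> simp [pos, h, PosTerm.tag]
  | lam x e ih =>
    by_cases h : u = x
    · simp [pos, h]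
    · simp only [pos, update_of_ne h]
      exact ih.trans (Nat.le_succ _)
  | app e₁ e₂ ih₁ ih₂ =>
    simp only [pos, depth]
    split_ifs <;> exact PosTerm.tag_combine_le (by omega) _

theorem height_pos_le_depth (e : Expression) (u : Name) :
    (e.pos u).elim 0 PosTerm.height ≤ e.depth := by
  induction e with
  | var v => by_cases h : u = v <;> simp [pos, h, PosTerm.height, depth]
  | lam x e ih =>
    by_cases h : u = x
    · simp [pos, h]
    · simp only [pos, update_of_ne h]
      exact ih.trans (Nat.le_succ _)
  | app e₁ e₂ ih₁ ih₂ =>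
    simp only [pos, depth]
    split_ifs <;> exact (PosTerm.height_combine_le _ _ _).trans (by omega)

theorem height_skeleton_le_depth (e : Expression) : e.skeleton.height ≤ e.depth := by
  induction e with
  | var v => exact le_rfl
  | lam x e ih =>
    exact Nat.succ_le_succ (max_le (height_pos_le_depth e x) ih)
  | app e₁ e₂ ih₁ ih₂ => exact Nat.succ_le_succ (max_le_max ih₁ ih₂)

theorem pos_app_inj {e₁ e₂ f₁ f₂ : Expression} {u v : Name}
    (h_big : leftBigger e₁ e₂ = leftBigger f₁ f₂) (h_depth₁ : e₁.depth = f₁.depth)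
    (h_depth₂ : e₂.depth = f₂.depth) (h : (app e₁ e₂).pos u = (app f₁ f₂).pos v) :
    e₁.pos u = f₁.pos v ∧ e₂.pos u = f₂.pos v := by
  have he₁ := tag_pos_le_depth e₁ u
  have he₂ := tag_pos_le_depth e₂ u
  have hf₁ := tag_pos_le_depth f₁ v
  have hf₂ := tag_pos_le_depth f₂ v
  simp only [pos, h_big, h_depth₁, h_depth₂] at h
  split_ifs at h
  · exact PosTerm.combine_inj (by omega) (by omega) h
  · exact (PosTerm.combine_inj (by omega) (by omega) h).symm

end Expression

/-- Two variable maps correspond under a list of pairs of binders. -/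
structure MapMatch (Γ : List (Name × Name)) (m m' : Name → Option PosTerm) : Prop where
  eq_of_varMatch : ∀ {u v}, VarMatch Γ u v → m u = m' v
  exists_varMatch : ∀ {u}, m u ≠ none → ∃ v, VarMatch Γ u v

namespace MapMatch

variable {Γ : List (Name × Name)}

theorem cons {m m' : Name → Option PosTerm} {x y : Name}
    (h : MapMatch Γ (update m x none) (update m' y none)) (hxy : m x = m' y) :
    MapMatch ((x, y) :: Γ) m m' where
  eq_of_varMatch := by
    rintro u v (⟨rfl, rfl⟩ | ⟨hu, hv, huv⟩)
    · exact hxy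
    · simpa only [update_of_ne hu, update_of_ne hv] using h.eq_of_varMatch huv
  exists_varMatch := by
    intro u hu
    rcases eq_or_ne u x with rfl | hux
    · exact ⟨y, .inl ⟨rfl, rfl⟩⟩
    have hu' : update m x none u ≠ none := by rwa [update_of_ne hux]
    obtain ⟨v, huv⟩ := h.exists_varMatch hu'
    refine ⟨v, .inr ⟨hux, ?_, huv⟩⟩
    rintro rfl
    exact hu' ((h.eq_of_varMatch huv).trans (update_self ..))

theorem of_app {e₁ e₂ f₁ f₂ : Expression} (h : MapMatch Γ (e₁.app e₂).pos (f₁.app f₂).pos)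
    (h_big : e₁.leftBigger e₂ = f₁.leftBigger f₂) (h_depth₁ : e₁.depth = f₁.depth)
    (h_depth₂ : e₂.depth = f₂.depth) : MapMatch Γ e₁.pos f₁.pos ∧ MapMatch Γ e₂.pos f₂.pos := by
  have h_pos {u v : Name} (huv : VarMatch Γ u v) : e₁.pos u = f₁.pos v ∧ e₂.pos u = f₂.pos v :=
    Expression.pos_app_inj h_big h_depth₁ h_depth₂ (h.eq_of_varMatch huv)
  have h_exists {u : Name} (hu : u ∈ (e₁.app e₂).freeVars) : ∃ v, VarMatch Γ u v :=
    h.exists_varMatch (Expression.mem_freeVars_iff.1 hu)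
  exact ⟨⟨fun huv => (h_pos huv).1, fun hu =>
      h_exists (Finset.mem_union_left _ (Expression.mem_freeVars_iff.2 hu))⟩,
    ⟨fun huv => (h_pos huv).2, fun hu =>
      h_exists (Finset.mem_union_right _ (Expression.mem_freeVars_iff.2 hu))⟩⟩

end MapMatch

theorem alphaEquivUnder_of_skeleton_eq {e f : Expression} {Γ : List (Name × Name)}
    (h_skel : e.skeleton = f.skeleton) (h_pos : MapMatch Γ e.pos f.pos) :
    AlphaEquivUnder Γ e f := by
  induction e generalizing f Γ with
  | var v =>
    rcases f with w | ⟨y, f⟩ | ⟨f₁, f₂⟩ <;>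
      simp only [Expression.skeleton, reduceCtorEq] at h_skel
    obtain ⟨w', hw'⟩ := h_pos.exists_varMatch (u := v) (by simp [Expression.pos])
    have h : some PosTerm.here = (Expression.var w).pos w' := by
      simpa [Expression.pos] using h_pos.eq_of_varMatch hw'
    obtain rfl : w' = w := by
      by_contra hne
      simp [Expression.pos, hne] at h
    exact hw'
  | lam x e ih =>
    rcases f with w | ⟨y, f⟩ | ⟨f₁, f₂⟩ <;>
      simp only [Expression.skeleton, reduceCtorEq, StructTerm.lam.injEq] at h_skel
    exact ih h_skel.2 (h_pos.cons h_skel.1)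
  | app e₁ e₂ ih₁ ih₂ =>
    rcases f with w | ⟨y, f⟩ | ⟨f₁, f₂⟩ <;>
      simp only [Expression.skeleton, reduceCtorEq, StructTerm.app.injEq] at h_skel
    obtain ⟨h_big, h₁, h₂⟩ := h_skel
    have h_depth {e f : Expression} (h : e.skeleton = f.skeleton) : e.depth = f.depth := by
      rw [← e.depth_skeleton, h, f.depth_skeleton]
    obtain ⟨h_pos₁, h_pos₂⟩ := h_pos.of_app h_big (h_depth h₁) (h_depth h₂)
    exact ⟨ih₁ h₁ h_pos₁, ih₂ h₂ h_pos₂⟩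

theorem alphaEquiv_of_skeleton_eq {e f : Expression} (h_skel : e.skeleton = f.skeleton)
    (h_pos : e.pos = f.pos) : AlphaEquiv e f :=
  alphaEquivUnder_of_skeleton_eq h_skel
    ⟨fun {u _} huv => h_pos ▸ congrArg e.pos (show u = _ from huv), fun {u} _ => ⟨u, rfl⟩⟩

/-! ### Evaluation of the summaries -/

section Evaluation

variable {b : ℕ}

theorem HashCode.xor_eq_add (g h : HashCode b) : g.xor h = g + h := rfl

theorem HashCode.add_self (g : HashCode b) : g + g = 0 := funext fun i => Bool.xor_self (g i)

variable (H : Hashing b)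

/-- The hash code of a position tree. -/
def PosTerm.hash : PosTerm → HashCode b
  | here => H.ptHere
  | graft t p => H.ptJoin (p.size + 1) t none p.hash
  | join t q p => H.ptJoin (q.size + p.size + 1) t (some q.hash) p.hash

/-- The representation of a position tree in the algorithm. -/
def PosTerm.toPosTree (p : PosTerm) : PosTree b := ⟨p.hash H, p.size⟩

/-- The hash code of a structure. -/
def StructTerm.hash : StructTerm → HashCode b
  | var => H.sVar
  | lam p s => H.sLam (s.size + 1) (p.map (PosTerm.hash H)) s.hash
  | app l s₁ s₂ => H.sApp (s₁.size + s₂.size + 1) l s₁.hash s₂.hash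

/-- The representation of a structure in the algorithm. -/
def StructTerm.toStructure (s : StructTerm) : Structure b := ⟨s.hash H, s.size, s.depth⟩

/-- The sum of the hashes of the entries of a variable map at the names in `S`. -/
def mapHash (S : Finset Name) (m : Name → Option (PosTree b)) : HashCode b :=
  ∑ v ∈ S, (m v).elim 0 (entryHash H v)

variable {H}

theorem mapHash_eq_of_subset {S T : Finset Name} {m : Name → Option (PosTree b)} (hST : S ⊆ T)
    (hS : ∀ v ∉ S, m v = none) : mapHash H S m = mapHash H T m :=
  Finset.sum_subset hST fun v _ hv => by rw [hS v hv, Option.elim_none]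

theorem mapHash_update {S : Finset Name} {k : Name} (hk : k ∈ S) (m : Name → Option (PosTree b))
    (o : Option (PosTree b)) :
    mapHash H S (update m k o) =
      mapHash H S m + (m k).elim 0 (entryHash H k) + o.elim 0 (entryHash H k) := by
  simp only [mapHash, apply_update fun v (o : Option (PosTree b)) => o.elim 0 (entryHash H v),
    Finset.sum_update_of_mem hk, Finset.sum_eq_add_sum_sdiff_singleton_of_mem hk]
  rw [add_right_comm ((m k).elim 0 (entryHash H k)), HashCode.add_self, zero_add, add_comm]

namespace VarMap

/-- The finite map underlying a variable map. -/
def lookup (m : VarMap b) (u : Name) : Option (PosTree b) := m.entries.lookup u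

variable (H) in
/-- The stored hash of a variable map is the sum of the hashes of its entries. -/
def Consistent (m : VarMap b) : Prop :=
  ∀ S : Finset Name, (∀ v ∉ S, m.lookup v = none) → m.hash = mapHash H S m.lookup

theorem Consistent.of_update {m m' : VarMap b} (hm : m.Consistent H) {k : Name}
    {o : Option (PosTree b)} (h_lookup : m'.lookup = update m.lookup k o)
    (h_hash : m'.hash =
      m.hash + (m.lookup k).elim 0 (entryHash H k) + o.elim 0 (entryHash H k)) :
    m'.Consistent H := by
  intro S hS
  rw [mapHash_eq_of_subset (Finset.subset_insert k S) hS, h_lookup,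
    mapHash_update (Finset.mem_insert_self k S), h_hash, ← hm]
  intro v hv
  rw [Finset.mem_insert, not_or] at hv
  rw [← hS v hv.2, h_lookup, update_of_ne hv.1]

theorem lookup_singletonVM (k : Name) (p : PosTree b) :
    (singletonVM H k p).lookup = update (fun _ => none) k (some p) := by
  ext1 u
  rcases eq_or_ne u k with rfl | hu
  · rw [update_self]
    exact AList.lookup_insert ∅
  · rw [update_of_ne hu]
    exact AList.lookup_insert_ne (s := ∅) hu

theorem consistent_singletonVM (k : Name) (p : PosTree b) : (singletonVM H k p).Consistent H := by
  have h_empty : Consistent H ⟨∅, 0⟩ := fun S _ => (Finset.sum_eq_zero fun _ _ => rfl).symm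
  exact h_empty.of_update (k := k) (o := some p) (lookup_singletonVM k p)
    (by simp [singletonVM, lookup])

theorem lookup_alterVM (f : Option (PosTree b) → PosTree b) (k : Name) (m : VarMap b) :
    (alterVM H f k m).lookup = update m.lookup k (some (f (m.lookup k))) := by
  ext1 u
  unfold alterVM lookup
  rcases eq_or_ne u k with rfl | hu
  · rw [update_self]
    split <;> rename_i h <;> rw [AList.lookup_insert, h]
  · rw [update_of_ne hu]
    split <;> exact AList.lookup_insert_ne hu

theorem hash_alterVM (f : Option (PosTree b) → PosTree b) (k : Name) (m : VarMap b) :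
    (alterVM H f k m).hash = m.hash + (m.lookup k).elim 0 (entryHash H k) +
      entryHash H k (f (m.lookup k)) := by
  unfold alterVM lookup
  split <;> rename_i h <;> simp [h, HashCode.xor_eq_add]

theorem Consistent.alterVM {m : VarMap b} (hm : m.Consistent H)
    (f : Option (PosTree b) → PosTree b) (k : Name) : (alterVM H f k m).Consistent H :=
  hm.of_update (lookup_alterVM f k m) (hash_alterVM f k m)

theorem lookup_removeFromVM (k : Name) (m : VarMap b) :
    (removeFromVM H k m).1.lookup = update m.lookup k none := by
  ext1 u
  unfold removeFromVM lookup
  rcases eq_or_ne u k with rfl | hu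
  · rw [update_self]
    split
    · exact AList.lookup_erase _ _
    · assumption
  · rw [update_of_ne hu]
    split
    · exact AList.lookup_erase_ne hu
    · rfl

theorem removeFromVM_snd (k : Name) (m : VarMap b) : (removeFromVM H k m).2 = m.lookup k := by
  unfold removeFromVM lookup
  split <;> rename_i h <;> exact h.symm

theorem hash_removeFromVM (k : Name) (m : VarMap b) :
    (removeFromVM H k m).1.hash = m.hash + (m.lookup k).elim 0 (entryHash H k) + 0 := by
  unfold removeFromVM lookup
  split <;> rename_i h <;> simp [h, HashCode.xor_eq_add]

theorem Consistent.removeFromVM {m : VarMap b} (hm : m.Consistent H) (k : Name) :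
    (removeFromVM H k m).1.Consistent H :=
  hm.of_update (lookup_removeFromVM k m) (hash_removeFromVM k m)

theorem Consistent.joinVM {m : VarMap b} (hm : m.Consistent H) (t : ℕ) (m' : VarMap b) :
    (joinVM H t m m').Consistent H := by
  unfold AlphaHash.joinVM
  induction m'.entries.entries with
  | nil => exact hm
  | cons kv l ih => exact Consistent.alterVM ih (fun mp => mkPTJoin H t mp kv.2) kv.1

theorem lookup_foldr_alterVM (t : ℕ) (m : VarMap b) {l : List (Σ _ : Name, PosTree b)}
    (hl : l.NodupKeys) (u : Name) :
    (l.foldr (fun kv m => alterVM H (fun mp => mkPTJoin H t mp kv.2) kv.1 m) m).lookup u =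
      (l.dlookup u).elim (m.lookup u) fun p => some (mkPTJoin H t (m.lookup u) p) := by
  induction l with
  | nil => rfl
  | cons kv l ih =>
    obtain ⟨k, p⟩ := kv
    obtain ⟨hk, h_nodup⟩ := List.nodupKeys_cons.1 hl
    rw [List.foldr_cons, lookup_alterVM]
    rcases eq_or_ne u k with rfl | hu
    · rw [update_self, ih h_nodup, List.dlookup_cons_eq, List.dlookup_eq_none.2 hk]
      rfl
    · rw [update_of_ne hu, ih h_nodup, List.dlookup_cons_ne _ _ hu]

theorem lookup_joinVM (t : ℕ) (m m' : VarMap b) (u : Name) :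
    (joinVM H t m m').lookup u =
      (m'.lookup u).elim (m.lookup u) fun p => some (mkPTJoin H t (m.lookup u) p) :=
  lookup_foldr_alterVM t m m'.entries.nodupKeys u

theorem lookup_joinVM_toPosTree {m m' : VarMap b} {u : Name} {q p : Option PosTerm} (t : ℕ)
    (hq : m.lookup u = q.map (PosTerm.toPosTree H))
    (hp : m'.lookup u = p.map (PosTerm.toPosTree H)) :
    (joinVM H t m m').lookup u = (PosTerm.combine t q p).map (PosTerm.toPosTree H) := by
  rw [lookup_joinVM, hq, hp]
  rcases q with _ | q <;> rcases p with _ | p <;>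
    simp [PosTerm.combine, PosTerm.toPosTree, mkPTJoin, PosTerm.hash, PosTerm.size]

theorem length_entries_eq_card_freeVars {m : VarMap b} {e : Expression}
    (h : m.lookup = Option.map (PosTerm.toPosTree H) ∘ e.pos) :
    m.entries.entries.length = e.freeVars.card := by
  have h_keys : m.entries.keys.toFinset = e.freeVars := by
    ext v
    rw [List.mem_toFinset, ← AList.mem_keys, ← not_iff_not, ← AList.lookup_eq_none,
      Expression.mem_freeVars_iff, not_not, ← Option.map_eq_none_iff (f := PosTerm.toPosTree H)]
    exact iff_of_eq (congrArg (· = none) (congrFun h v))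
  rw [← h_keys, List.toFinset_card_of_nodup m.entries.keys_nodup, AList.keys, List.keys,
    List.length_map]

end VarMap

theorem summariseExpr_str_and_lookup (e : Expression) :
    (summariseExpr H e).str = e.skeleton.toStructure H ∧
      (summariseExpr H e).vm.lookup = Option.map (PosTerm.toPosTree H) ∘ e.pos := by
  induction e with
  | var v =>
    refine ⟨rfl, ?_⟩
    simp only [summariseExpr, VarMap.lookup_singletonVM, Expression.pos, comp_update]
    rfl
  | lam x e ih =>
    constructor
    · simp [summariseExpr, VarMap.removeFromVM_snd, ih, mkSLam, Expression.skeleton,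
        StructTerm.toStructure, StructTerm.hash, StructTerm.size, StructTerm.depth, comp_def,
        PosTerm.toPosTree]
    · simp only [summariseExpr, VarMap.lookup_removeFromVM, ih.2, Expression.pos, comp_update,
        Option.map_none]
  | app e₁ e₂ ih₁ ih₂ =>
    have h_big : isBiggerThanVM (summariseExpr H e₁).vm (summariseExpr H e₂).vm =
        e₁.leftBigger e₂ := by
      rw [isBiggerThanVM, Expression.leftBigger, VarMap.length_entries_eq_card_freeVars ih₁.2,
        VarMap.length_entries_eq_card_freeVars ih₂.2]
    constructor
    · simp only [summariseExpr, h_big, ih₁.1, ih₂.1]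
      rfl
    · ext1 u
      simp only [summariseExpr, h_big, ih₁.1, ih₂.1, structureTag, mkSApp, StructTerm.toStructure,
        Expression.depth_skeleton, comp_apply, Expression.pos]
      split_ifs
      · exact VarMap.lookup_joinVM_toPosTree _ (congrFun ih₁.2 u) (congrFun ih₂.2 u)
      · exact VarMap.lookup_joinVM_toPosTree _ (congrFun ih₂.2 u) (congrFun ih₁.2 u)

theorem consistent_summariseExpr (e : Expression) : (summariseExpr H e).vm.Consistent H := by
  induction e with
  | var v => exact VarMap.consistent_singletonVM v (mkPTHere H)
  | lam x e ih => exact ih.removeFromVM x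
  | app e₁ e₂ ih₁ ih₂ =>
    simp only [summariseExpr]
    split_ifs
    · exact ih₁.joinVM _ _
    · exact ih₂.joinVM _ _

theorem hashExpr_eq {e : Expression} {S : Finset Name} (hS : e.freeVars ⊆ S) :
    hashExpr H e =
      H.summary (e.skeleton.hash H) (mapHash H S (Option.map (PosTerm.toPosTree H) ∘ e.pos)) := by
  obtain ⟨h_str, h_lookup⟩ := summariseExpr_str_and_lookup (H := H) e
  rw [hashExpr, hashESummary, h_str, consistent_summariseExpr e S, h_lookup]
  · rfl
  · intro v hv
    rw [h_lookup, comp_apply, not_not.1 (mt Expression.mem_freeVars_iff.2 (mt (@hS v) hv)),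
      Option.map_none]

end Evaluation

/-! ### Collision probabilities -/

section Oracle

open RandomOracle

variable {b : ℕ}

instance : Countable Name :=
  Injective.countable (f := fun v : Name => v.toList.map Char.toNat) fun _ _ h =>
    String.toList_inj.1 (List.map_injective_iff.2 (fun _ _ => Char.toNat_inj.1) h)

/-- The points at which the hashing functions and combiners can be evaluated. -/
inductive Query (b : ℕ) where
  | sVar
  | sLam (size : ℕ) (p : Option (HashCode b)) (s : HashCode b)
  | sApp (size : ℕ) (leftBigger : Bool) (s₁ s₂ : HashCode b)
  | ptHere
  | ptJoin (size tag : ℕ) (big : Option (HashCode b)) (small : HashCode b)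
  | entry (v : Name) (p : HashCode b)
  | summary (s m : HashCode b)
  deriving DecidableEq, Countable

/-- The hashing functions that answer each query as prescribed by `ω`. -/
def hashing (ω : Query b → HashCode b) : Hashing b where
  sVar := ω .sVar
  sLam n p s := ω (.sLam n p s)
  sApp n l s₁ s₂ := ω (.sApp n l s₁ s₂)
  ptHere := ω .ptHere
  ptJoin k t q p := ω (.ptJoin k t q p)
  entry v p := ω (.entry v p)
  summary s m := ω (.summary s m)

/-- The order in which the algorithm makes its queries: position trees and then structures, each by
increasing size, then entries, then the summary. -/
def Query.rank : Query b → ℕ ×ₗ ℕ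
  | ptHere => toLex (0, 1)
  | ptJoin k _ _ _ => toLex (0, k)
  | sVar => toLex (1, 1)
  | sLam n _ _ => toLex (1, n)
  | sApp n _ _ _ => toLex (1, n)
  | entry _ _ => toLex (2, 0)
  | summary _ _ => toLex (3, 0)

instance : MeasurableSpace (Query b) := ⊤

instance : DiscreteMeasurableSpace (Query b) := ⟨fun _ => trivial⟩

instance : MeasurableAdd₂ (HashCode b) := ⟨.of_discrete⟩

/-- The distribution under which all queries are answered independently and uniformly. -/
noncomputable def oracle (b : ℕ) : Measure (Query b → HashCode b) :=
  Measure.infinitePi fun _ => uniformOn Set.univ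

instance : IsProbabilityMeasure (oracle b) := by
  unfold oracle
  infer_instance

theorem uniformOn_singleton_le (g : HashCode b) :
    uniformOn Set.univ {g} ≤ (2 ^ b : ℝ≥0∞)⁻¹ := by
  rw [uniformOn_univ, Measure.count_singleton]
  simp

theorem oracle_le_of_subset {s t : Set (Query b → HashCode b)} {m n : ℕ} {ε : ℝ≥0∞}
    (ht : oracle b t ≤ m * ε) (hst : s ⊆ t) (hmn : m ≤ n) : oracle b s ≤ n * ε :=
  (measure_mono hst).trans (ht.trans (by gcongr))

theorem oracle_answer_eq_le {r r' : ℕ ×ₗ ℕ} {A A' : (Query b → HashCode b) → Query b}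
    (hA : IsQueryOfRank Query.rank r A) (hA' : IsQueryOfRank Query.rank r' A') {n : ℕ}
    (h_eq : oracle b {ω | A ω = A' ω} ≤ n * (2 ^ b)⁻¹) :
    oracle b {ω | ω (A ω) = ω (A' ω)} ≤ (n + 1 : ℕ) * (2 ^ b)⁻¹ :=
  hA.measure_answer_eq_le_succ hA' (fun _ => uniformOn_singleton_le) h_eq

namespace PosTerm

/-- The query whose answer is the hash code of a position tree. -/
def query (ω : Query b → HashCode b) : PosTerm → Query b
  | here => .ptHere
  | graft t p => .ptJoin (p.size + 1) t none (p.hash (hashing ω))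
  | join t q p => .ptJoin (q.size + p.size + 1) t (some (q.hash (hashing ω))) (p.hash (hashing ω))

theorem hash_hashing (p : PosTerm) (ω : Query b → HashCode b) :
    p.hash (hashing ω) = ω (p.query ω) := by
  cases p <;> rfl

theorem isQueryOfRank_query (p : PosTerm) :
    IsQueryOfRank (Query.rank (b := b)) (toLex (0, p.size)) (query · p) := by
  induction p with
  | here => exact ⟨measurable_const, fun _ => rfl⟩
  | graft t p ih =>
    have hp := ih.measurable_answer (r' := toLex (0, p.size + 1))
      (by simp [Prod.Lex.toLex_lt_toLex])
    simp only [← hash_hashing] at hp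
    exact ⟨(Measurable.of_discrete (f := Query.ptJoin _ t none)).comp hp, fun _ => rfl⟩
  | join t q p ihq ihp =>
    have hq := ihq.measurable_answer (r' := toLex (0, q.size + p.size + 1))
      (by simp [Prod.Lex.toLex_lt_toLex])
    have hp := ihp.measurable_answer (r' := toLex (0, q.size + p.size + 1))
      (by simp [Prod.Lex.toLex_lt_toLex])
    simp only [← hash_hashing] at hq hp
    exact ⟨measurable_map₂ (fun c d => Query.ptJoin _ t (some c) d) hq hp, fun _ => rfl⟩

theorem measurable_hash (p : PosTerm) {i : ℕ × ℕ} (hi : 0 < i.1) :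
    Measurable[answersBelow (Query.rank (b := b)) (toLex i)] fun ω => p.hash (hashing ω) := by
  simp only [hash_hashing]
  exact p.isQueryOfRank_query.measurable_answer (Prod.Lex.toLex_lt_toLex.2 (.inl hi))

theorem oracle_hash_eq_le {p p' : PosTerm} (hp : p ≠ p') :
    oracle b {ω | p.hash (hashing ω) = p'.hash (hashing ω)} ≤ p.height * (2 ^ b)⁻¹ := by
  induction p generalizing p' with
  | here =>
    simp only [hash_hashing]
    refine oracle_answer_eq_le (isQueryOfRank_query _) (isQueryOfRank_query _) (n := 0) ?_
    cases p' <;> simp [query] at hp ⊢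
  | graft t p ih =>
    simp only [hash_hashing]
    refine oracle_answer_eq_le (isQueryOfRank_query _) (isQueryOfRank_query _) ?_
    rcases p' with _ | ⟨t', p'⟩ | ⟨t', q', p'⟩
    · simp [query]
    · by_cases h : p = p'
      · simp_all [query]
      · exact oracle_le_of_subset (ih h) (by simp +contextual [query]) le_rfl
    · simp [query]
  | join t q p ihq ihp =>
    simp only [hash_hashing]
    refine oracle_answer_eq_le (isQueryOfRank_query _) (isQueryOfRank_query _) ?_
    rcases p' with _ | ⟨t', p'⟩ | ⟨t', q', p'⟩
    · simp [query]
    · simp [query]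
    · by_cases hq : q = q'
      · by_cases h : p = p'
        · simp_all [query]
        · exact oracle_le_of_subset (ihp h) (by simp +contextual [query]) (le_max_right _ _)
      · exact oracle_le_of_subset (ihq hq) (by simp +contextual [query]) (le_max_left _ _)

theorem oracle_map_hash_eq_le {o o' : Option PosTerm} (ho : o ≠ o') :
    oracle b {ω | o.map (hash (hashing ω)) = o'.map (hash (hashing ω))} ≤
      (o.elim 0 height : ℕ) * (2 ^ b)⁻¹ := by
  rcases o with _ | p <;> rcases o' with _ | p'
  · exact absurd rfl ho
  · simp
  · simp
  · simpa using oracle_hash_eq_le (mt (congrArg some) ho)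

end PosTerm

namespace StructTerm

/-- The query whose answer is the hash code of a structure. -/
def query (ω : Query b → HashCode b) : StructTerm → Query b
  | var => .sVar
  | lam p s => .sLam (s.size + 1) (p.map (PosTerm.hash (hashing ω))) (s.hash (hashing ω))
  | app l s₁ s₂ => .sApp (s₁.size + s₂.size + 1) l (s₁.hash (hashing ω)) (s₂.hash (hashing ω))

theorem hash_hashing (s : StructTerm) (ω : Query b → HashCode b) :
    s.hash (hashing ω) = ω (s.query ω) := by
  cases s <;> rfl

theorem isQueryOfRank_query (s : StructTerm) :
    IsQueryOfRank (Query.rank (b := b)) (toLex (1, s.size)) (query · s) := by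
  induction s with
  | var => exact ⟨measurable_const, fun _ => rfl⟩
  | lam p s ih =>
    have hs := ih.measurable_answer (r' := toLex (1, s.size + 1))
      (by simp [Prod.Lex.toLex_lt_toLex])
    simp only [← hash_hashing] at hs
    refine ⟨?_, fun _ => rfl⟩
    rcases p with _ | p
    · exact (Measurable.of_discrete (f := Query.sLam _ none)).comp hs
    · exact measurable_map₂ (fun c d => Query.sLam _ (some c) d) (p.measurable_hash one_pos) hs
  | app l s₁ s₂ ih₁ ih₂ =>
    have h₁ := ih₁.measurable_answer (r' := toLex (1, s₁.size + s₂.size + 1))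
      (by simp [Prod.Lex.toLex_lt_toLex])
    have h₂ := ih₂.measurable_answer (r' := toLex (1, s₁.size + s₂.size + 1))
      (by simp [Prod.Lex.toLex_lt_toLex])
    simp only [← hash_hashing] at h₁ h₂
    exact ⟨measurable_map₂ (Query.sApp _ l) h₁ h₂, fun _ => rfl⟩

theorem measurable_hash (s : StructTerm) {i : ℕ × ℕ} (hi : 1 < i.1) :
    Measurable[answersBelow (Query.rank (b := b)) (toLex i)] fun ω => s.hash (hashing ω) := by
  simp only [hash_hashing]
  exact s.isQueryOfRank_query.measurable_answer (Prod.Lex.toLex_lt_toLex.2 (.inl hi))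

theorem oracle_hash_eq_le {s s' : StructTerm} (hs : s ≠ s') :
    oracle b {ω | s.hash (hashing ω) = s'.hash (hashing ω)} ≤ s.height * (2 ^ b)⁻¹ := by
  induction s generalizing s' with
  | var =>
    simp only [hash_hashing]
    refine oracle_answer_eq_le (isQueryOfRank_query _) (isQueryOfRank_query _) (n := 0) ?_
    cases s' <;> simp [query] at hs ⊢
  | lam p s ih =>
    simp only [hash_hashing]
    refine oracle_answer_eq_le (isQueryOfRank_query _) (isQueryOfRank_query _) ?_
    rcases s' with _ | ⟨p', s'⟩ | ⟨l', s₁', s₂'⟩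
    · simp [query]
    · by_cases hp : p = p'
      · by_cases h : s = s'
        · simp_all
        · exact oracle_le_of_subset (ih h) (by simp +contextual [query]) (le_max_right _ _)
      · exact oracle_le_of_subset (PosTerm.oracle_map_hash_eq_le hp)
          (by simp +contextual [query]) (le_max_left _ _)
    · simp [query]
  | app l s₁ s₂ ih₁ ih₂ =>
    simp only [hash_hashing]
    refine oracle_answer_eq_le (isQueryOfRank_query _) (isQueryOfRank_query _) ?_
    rcases s' with _ | ⟨p', s'⟩ | ⟨l', s₁', s₂'⟩
    · simp [query]
    · simp [query]
    · by_cases h₁ : s₁ = s₁'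
      · by_cases h₂ : s₂ = s₂'
        · simp_all [query]
        · exact oracle_le_of_subset (ih₂ h₂) (by simp +contextual [query]) (le_max_right _ _)
      · exact oracle_le_of_subset (ih₁ h₁) (by simp +contextual [query]) (le_max_left _ _)

end StructTerm

theorem PosTerm.isQueryOfRank_entry (v : Name) (p : PosTerm) :
    IsQueryOfRank (Query.rank (b := b)) (toLex (2, 0)) fun ω => .entry v (p.hash (hashing ω)) :=
  ⟨(Measurable.of_discrete (f := Query.entry v)).comp (p.measurable_hash two_pos), fun _ => rfl⟩

theorem PosTerm.hash_update_entry (ω : Query b → HashCode b) (v : Name) (g c : HashCode b) :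
    PosTerm.hash (hashing (update ω (.entry v g) c)) = PosTerm.hash (hashing ω) :=
  funext fun p => update_eq_of_measurable_answersBelow (rank := Query.rank)
    (p.measurable_hash (i := (2, 0)) two_pos) le_rfl ω c

theorem PosTerm.measurableSet_map_hash_eq (o o' : Option PosTerm) :
    MeasurableSet {ω : Query b → HashCode b |
      o.map (PosTerm.hash (hashing ω)) = o'.map (PosTerm.hash (hashing ω))} := by
  have h_meas (p : PosTerm) : Measurable fun ω : Query b → HashCode b => p.hash (hashing ω) :=
    (p.measurable_hash (i := (1, 0)) one_pos).mono cylinderEvents_le_pi le_rfl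
  rcases o with _ | p <;> rcases o' with _ | p'
  · simp
  · simp
  · simp
  · simpa using measurableSet_eq_fun (h_meas p) (h_meas p')

/-- The contribution of a name to the hash of a variable map, when the queries are answered by
`ω`. -/
def entryAnswer (ω : Query b → HashCode b) (v : Name) (o : Option PosTerm) : HashCode b :=
  o.elim 0 fun p => ω (.entry v (p.hash (hashing ω)))

theorem mapHash_hashing (ω : Query b → HashCode b) (S : Finset Name)
    (m : Name → Option PosTerm) :
    mapHash (hashing ω) S (Option.map (PosTerm.toPosTree (hashing ω)) ∘ m) =
      ∑ v ∈ S, entryAnswer ω v (m v) :=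
  Finset.sum_congr rfl fun _ _ => Option.elim_map ..

theorem measurable_entryAnswer (v : Name) (o : Option PosTerm) :
    Measurable[answersBelow (Query.rank (b := b)) (toLex (3, 0))] fun ω => entryAnswer ω v o := by
  rcases o with _ | p
  · exact measurable_const
  · exact (p.isQueryOfRank_entry v).measurable_answer (by simp [Prod.Lex.toLex_lt_toLex])

theorem entryAnswer_update {ω : Query b → HashCode b} {u v : Name} {g : HashCode b}
    {o : Option PosTerm} (h : u = v → o.map (PosTerm.hash (hashing ω)) ≠ some g)
    (c : HashCode b) : entryAnswer (update ω (.entry v g) c) u o = entryAnswer ω u o := by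
  rcases o with _ | q
  · rfl
  · simp only [entryAnswer, Option.elim_some, PosTerm.hash_update_entry]
    refine update_of_ne (fun h_eq => ?_) _ _
    obtain ⟨huv, hqg⟩ := Query.entry.inj h_eq
    exact h huv (congrArg some hqg)

theorem oracle_sum_entryAnswer_eq_le_of_some {S : Finset Name} {m m' : Name → Option PosTerm}
    {v : Name} (hv : v ∈ S) {p : PosTerm} (hp : m v = some p) :
    oracle b {ω | (m v).map (PosTerm.hash (hashing ω)) ≠ (m' v).map (PosTerm.hash (hashing ω)) ∧
      ∑ u ∈ S, entryAnswer ω u (m u) = ∑ u ∈ S, entryAnswer ω u (m' u)} ≤ (2 ^ b)⁻¹ := by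
  have h_meas (u : Name) (o : Option PosTerm) : Measurable fun ω => entryAnswer (b := b) ω u o :=
    (measurable_entryAnswer u o).mono cylinderEvents_le_pi le_rfl
  have h_fresh := measure_answer_eq_le (ι := Query b) (fun _ => uniformOn_singleton_le)
    (E := {ω | (m v).map (PosTerm.hash (hashing ω)) ≠ (m' v).map (PosTerm.hash (hashing ω))})
    (A := fun ω => .entry v (p.hash (hashing ω)))
    (B := fun ω => ∑ u ∈ S, entryAnswer ω u (m' u) - ∑ u ∈ S \ {v}, entryAnswer ω u (m u))
    (PosTerm.measurableSet_map_hash_eq _ _).compl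
    ((p.isQueryOfRank_entry v).measurable.mono cylinderEvents_le_pi le_rfl)
    (measurable_map₂ _ (Finset.measurable_sum _ fun u _ => h_meas u _)
      (Finset.measurable_sum _ fun u _ => h_meas u _)) ?_
  · refine (measure_mono ?_).trans h_fresh
    rintro ω ⟨h_ne, h_eq⟩
    rw [Finset.sum_eq_add_sum_sdiff_singleton_of_mem hv, hp] at h_eq
    exact ⟨h_ne, eq_sub_of_add_eq h_eq⟩
  · intro ω h_ne c
    refine ⟨?_, ?_, ?_⟩
    · rwa [Set.mem_ofPred_eq, PosTerm.hash_update_entry]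
    · rw [PosTerm.hash_update_entry]
    · refine congrArg₂ _ (Finset.sum_congr rfl fun u _ => entryAnswer_update ?_ c)
        (Finset.sum_congr rfl fun u hu => entryAnswer_update (fun huv => ?_) c)
      · rintro rfl h
        exact h_ne (by rw [h, hp, Option.map_some])
      · exact absurd (Finset.mem_singleton.2 huv) (Finset.mem_sdiff.1 hu).2

theorem oracle_mapHash_eq_le {S : Finset Name} {m m' : Name → Option PosTerm} {v : Name}
    (hv : v ∈ S) (h_ne : m v ≠ m' v) :
    oracle b {ω | ∑ u ∈ S, entryAnswer ω u (m u) = ∑ u ∈ S, entryAnswer ω u (m' u)} ≤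
      (max ((m v).elim 0 PosTerm.height) ((m' v).elim 0 PosTerm.height) + 1 : ℕ) * (2 ^ b)⁻¹ := by
  wlog h_some : ∃ p, m v = some p generalizing m m'
  · rw [← Option.ne_none_iff_exists', not_not] at h_some
    simpa only [eq_comm, max_comm] using
      this h_ne.symm (Option.ne_none_iff_exists'.1 fun h => h_ne (h_some.trans h.symm))
  obtain ⟨p, hp⟩ := h_some
  rw [Nat.cast_succ, add_one_mul]
  refine (measure_mono fun ω hω => ?_).trans <| (measure_union_le _ _).trans <|
    add_le_add (oracle_le_of_subset (PosTerm.oracle_map_hash_eq_le h_ne) subset_rfl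
      (le_max_left _ _)) (oracle_sum_entryAnswer_eq_le_of_some (m' := m') hv hp)
  exact (em _).imp id fun h => ⟨h, hω⟩

/-- The query whose answer is the hash of an expression with free variables in `S`. -/
def summaryQuery (S : Finset Name) (e : Expression) (ω : Query b → HashCode b) : Query b :=
  .summary (e.skeleton.hash (hashing ω)) (∑ v ∈ S, entryAnswer ω v (e.pos v))

theorem hashExpr_hashing {e : Expression} {S : Finset Name} (hS : e.freeVars ⊆ S)
    (ω : Query b → HashCode b) : hashExpr (hashing ω) e = ω (summaryQuery S e ω) := by
  rw [hashExpr_eq hS, mapHash_hashing]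
  rfl

theorem isQueryOfRank_summaryQuery (S : Finset Name) (e : Expression) :
    IsQueryOfRank (Query.rank (b := b)) (toLex (3, 0)) (summaryQuery S e) :=
  ⟨measurable_map₂ Query.summary (e.skeleton.measurable_hash (by simp))
    (Finset.measurable_sum _ fun v _ => measurable_entryAnswer v (e.pos v)), fun _ => rfl⟩

theorem measurable_hashExpr (e : Expression) :
    Measurable fun ω : Query b → HashCode b => hashExpr (hashing ω) e := by
  simp only [hashExpr_hashing (subset_refl e.freeVars)]
  exact ((isQueryOfRank_summaryQuery _ e).measurable_answer (r' := toLex (4, 0))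
    (by simp [Prod.Lex.toLex_lt_toLex])).mono cylinderEvents_le_pi le_rfl

theorem oracle_hashExpr_eq_le {e f : Expression} (h : ¬ AlphaEquiv e f) :
    oracle b {ω | hashExpr (hashing ω) e = hashExpr (hashing ω) f} ≤
      (max e.depth f.depth + 2 : ℕ) * (2 ^ b)⁻¹ := by
  simp only [hashExpr_hashing (Finset.subset_union_left (s₁ := e.freeVars) (s₂ := f.freeVars)),
    hashExpr_hashing (Finset.subset_union_right (s₁ := e.freeVars) (s₂ := f.freeVars))]
  refine oracle_answer_eq_le (isQueryOfRank_summaryQuery _ e) (isQueryOfRank_summaryQuery _ f) ?_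
  by_cases h_skel : e.skeleton = f.skeleton
  · obtain ⟨v, hv⟩ := Function.ne_iff.1 fun h_pos => h (alphaEquiv_of_skeleton_eq h_skel h_pos)
    have hvS : v ∈ e.freeVars ∪ f.freeVars := by
      by_contra hvS
      simp only [Finset.mem_union, Expression.mem_freeVars_iff, not_or, not_not] at hvS
      exact hv (hvS.1.trans hvS.2.symm)
    refine oracle_le_of_subset (oracle_mapHash_eq_le hvS hv) (fun ω hω => ?_) <|
      Nat.succ_le_succ (max_le_max (e.height_pos_le_depth v) (f.height_pos_le_depth v))
    exact (Query.summary.inj hω).2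
  · refine oracle_le_of_subset (StructTerm.oracle_hash_eq_le h_skel) (fun ω hω => ?_) <|
      (e.height_skeleton_le_depth.trans (le_max_left _ _)).trans (Nat.le_succ _)
    exact (Query.summary.inj hω).1

end Oracle

end AlphaHash

theorem mainTheorem1 (b : ℕ) (hb : 0 < b) :
    ∃ (Ω : Type) (_ : MeasurableSpace Ω) (P : MeasureTheory.Measure Ω)
      (_ : MeasureTheory.IsProbabilityMeasure P) (H : Ω → AlphaHash.Hashing b),
      (∀ e : AlphaHash.Expression, Measurable fun ω => AlphaHash.hashExpr (H ω) e) ∧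
      ∀ e₁ e₂ : AlphaHash.Expression, ¬ AlphaHash.AlphaEquiv e₁ e₂ →
        P.real {ω | AlphaHash.hashESummary (H ω) (AlphaHash.summariseExpr (H ω) e₁) =
            AlphaHash.hashESummary (H ω) (AlphaHash.summariseExpr (H ω) e₂)} ≤
          5 * ((e₁.size : ℝ) + (e₂.size : ℝ)) / 2 ^ b := by
  refine ⟨AlphaHash.Query b → AlphaHash.HashCode b, inferInstance, AlphaHash.oracle b,
    inferInstance, AlphaHash.hashing, AlphaHash.measurable_hashExpr, fun e₁ e₂ h => ?_⟩
  have h_prob := ENNReal.toReal_mono (by finiteness) (AlphaHash.oracle_hashExpr_eq_le (b := b) h)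
  rw [ENNReal.toReal_mul, ENNReal.toReal_natCast, ENNReal.toReal_inv, ENNReal.toReal_pow,
    ENNReal.toReal_ofNat] at h_prob
  have h_size : ((max e₁.depth e₂.depth + 2 : ℕ) : ℝ) ≤ 5 * (e₁.size + e₂.size) := by
    have h₁ := e₁.depth_le_size
    have h₂ := e₂.depth_le_size
    have h_pos := e₁.size_pos
    exact_mod_cast (by omega : max e₁.depth e₂.depth + 2 ≤ 5 * (e₁.size + e₂.size))
  calc (AlphaHash.oracle b).real {ω | AlphaHash.hashExpr (AlphaHash.hashing ω) e₁ =
        AlphaHash.hashExpr (AlphaHash.hashing ω) e₂}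
      ≤ (max e₁.depth e₂.depth + 2 : ℕ) * ((2 : ℝ) ^ b)⁻¹ := h_prob
    _ ≤ 5 * (e₁.size + e₂.size) * ((2 : ℝ) ^ b)⁻¹ := by gcongr
    _ = 5 * (e₁.size + e₂.size) / 2 ^ b := (div_eq_mul_inv _ _).symm
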